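/- Let $(\Omega,\mathcal F,\mathbb Q)$ be a probability space with a filtration $(\mathcal F_t)_{t\ge 0}$ satisfying the usual conditions, where $\mathbb Q$ is the risk-neutral measure. Let $\lambda_{Y_1},\lambda_{J_1},\lambda_{J_2}>0$, $\sigma_{Y_1},\phi_{Y_1}\in\mathbb R$, $\theta_1,\theta_2\ge 0$ and $\beta_1^*,\beta_2^*>0$. Let $W$ be an $(\mathcal F_t)$-Brownian motion under $\mathbb Q$, and for $i=1,2$ let $\Pi_i$ be a compound Poisson process under $\mathbb Q$ with constant jump intensity $\theta_i$ and exponentially distributed jump sizes with rate $\beta_i^*$ (that is, with mean $1/\beta_i^*$), adapted to $(\mathcal F_t)$ and with increments $\Pi_i(t)-\Pi_i(s)$, $s\le t$, independent of $\mathcal F_s$. Let $f:[0,\infty)\to\mathbb R$ be a deterministic function, and let the spot price in the 3-factor model be $$P_t=f(t)+Y_1(t)+J_1(t)-J_2(t),\qquad t\ge 0,$$ where $Y_1,J_1,J_2$ are adapted processes with $Y_1(0)=J_1(0)=J_2(0)=0$ and risk-neutral dynamics $$dY_1(t)=\bigl(-\lambda_{Y_1}^{-1}Y_1(t)-\phi_{Y_1}\bigr)\,dt+\sigma_{Y_1}\,dW(t),\qquad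 dJ_i(t)=-\lambda_{J_i}^{-1}J_i(t)\,dt+d\Pi_i(t),\quad i=1,2.$$ Then for all $0\le t\le T$ the random variable $P_T$ is $\mathbb Q$-integrable, and the price at time $t$ of a futures contract on the spot price with maturity $T$ is, $\mathbb Q$-almost surely, $$\begin{aligned}F(t,T,P)=\mathbb E^{\mathbb Q}[P_T\mid\mathcal F_t]={}&f(T)+Y_1(t)e^{-\lambda_{Y_1}^{-1}(T-t)}-\frac{\phi_{Y_1}}{\lambda_{Y_1}^{-1}}\bigl(1-e^{-\lambda_{Y_1}^{-1}(T-t)}\bigr)\\&+J_1(t)e^{-\lambda_{J_1}^{-1}(T-t)}+\frac{\theta_1}{\beta_1^*}\lambda_{J_1}\bigl(1-e^{-\lambda_{J_1}^{-1}(T-t)}\bigr)\\&-J_2(t)e^{-\lambda_{J_2}^{-1}(T-t)}-\frac{\theta_2}{\beta_2^*}\lambda_{J_2}\bigl(1-e^{-\lambda_{J_2}^{-1}(T-t)}\bigr).\end{aligned}$$ -/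

import Mathlib

open MeasureTheory ProbabilityTheory Set
open scoped NNReal

namespace Futures

/-- The usual conditions: the filtration is right-continuous and `𝓕 0` contains every `Q`-null
set. -/
structure UsualConditions {Ω : Type*} {mΩ : MeasurableSpace Ω}
    (𝓕 : Filtration ℝ≥0 mΩ) (Q : Measure Ω) : Prop where
  rightContinuous : 𝓕.IsRightContinuous
  complete : ∀ A : Set Ω, Q A = 0 → MeasurableSet[𝓕 0] A

/-- The increments of `X` after time `s` are independent of the information `𝓕 s`. -/
def IncrementsIndepOfPast {Ω : Type*} {mΩ : MeasurableSpace Ω}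
    (𝓕 : Filtration ℝ≥0 mΩ) (Q : Measure Ω) (X : ℝ≥0 → Ω → ℝ) : Prop :=
  ∀ s t : ℝ≥0, s ≤ t →
    Indep (MeasurableSpace.comap (fun ω ↦ X t ω - X s ω) inferInstance) (𝓕 s) Q

/-- `W` is a standard Brownian motion with respect to the filtration `𝓕` under `Q`. -/
structure IsFiltrationBrownian {Ω : Type*} {mΩ : MeasurableSpace Ω}
    (𝓕 : Filtration ℝ≥0 mΩ) (Q : Measure Ω) (W : ℝ≥0 → Ω → ℝ) : Prop where
  brownian : IsBrownianReal W Q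
  adapted : StronglyAdapted 𝓕 W
  indep : IncrementsIndepOfPast 𝓕 Q W

/-- `N` is a homogeneous Poisson process with intensity `θ` under `Q`: it starts at `0`, has
independent increments, `N t - N s` is Poisson distributed with parameter `θ (t - s)`, and its
paths are almost surely nondecreasing and right-continuous. -/
structure IsPoissonProcess {Ω : Type*} {mΩ : MeasurableSpace Ω}
    (Q : Measure Ω) (θ : ℝ≥0) (N : ℝ≥0 → Ω → ℕ) : Prop where
  measurable : ∀ t, Measurable (N t)
  zero : ∀ᵐ ω ∂Q, N 0 ω = 0
  indep : HasIndepIncrements (fun t ω ↦ (N t ω : ℝ)) Q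
  law : ∀ s t : ℝ≥0, s ≤ t →
    HasLaw (fun ω ↦ (N t ω : ℝ) - (N s ω : ℝ))
      ((poissonMeasure (θ * (t - s))).map (Nat.cast : ℕ → ℝ)) Q
  mono : ∀ᵐ ω ∂Q, Monotone (fun t ↦ N t ω)
  rightContinuous : ∀ᵐ ω ∂Q, ∀ t : ℝ≥0, ContinuousWithinAt (fun s ↦ N s ω) (Ici t) t

/-- `X` is a compound Poisson process with jump intensity `θ` and jump size distribution `ν`
under `Q`: `X t` is the sum of the sizes `ξ j` of the jumps that arrive up to time `t`, where the
arrivals are counted by a Poisson process `N` with intensity `θ` and the jump sizes are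
independent of each other and of `N`, with law `ν`. -/
def IsCompoundPoisson {Ω : Type*} {mΩ : MeasurableSpace Ω}
    (Q : Measure Ω) (θ : ℝ≥0) (ν : Measure ℝ) (X : ℝ≥0 → Ω → ℝ) : Prop :=
  ∃ (N : ℝ≥0 → Ω → ℕ) (ξ : ℕ → Ω → ℝ),
    IsPoissonProcess Q θ N ∧
    (∀ j, Measurable (ξ j)) ∧
    (∀ j, HasLaw (ξ j) ν Q) ∧
    iIndepFun ξ Q ∧
    IndepFun (fun ω j ↦ ξ j ω) (fun ω t ↦ N t ω) Q ∧
    ∀ᵐ ω ∂Q, ∀ t, X t ω = ∑ j ∈ Finset.range (N t ω), ξ j ω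

/-- `X` is a compound Poisson process with respect to the filtration `𝓕` under `Q`. -/
structure IsFiltrationCompoundPoisson {Ω : Type*} {mΩ : MeasurableSpace Ω}
    (𝓕 : Filtration ℝ≥0 mΩ) (Q : Measure Ω) (θ : ℝ≥0) (ν : Measure ℝ)
    (X : ℝ≥0 → Ω → ℝ) : Prop where
  compoundPoisson : IsCompoundPoisson Q θ ν X
  adapted : StronglyAdapted 𝓕 X
  indep : IncrementsIndepOfPast 𝓕 Q X

/-- `Y` is a solution of the (generalized) Ornstein-Uhlenbeck equation
`dY(t) = (-lam⁻¹ Y(t) - φ) dt + dZ(t)`, `Y(0) = 0`, driven by the process `Z`. The driver enters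
additively, so its stochastic integral over `[0, t]` is the increment `Z t - Z 0`. -/
structure IsOUSolution {Ω : Type*} {mΩ : MeasurableSpace Ω}
    (𝓕 : Filtration ℝ≥0 mΩ) (Q : Measure Ω) (lam φ : ℝ) (Z Y : ℝ≥0 → Ω → ℝ) : Prop where
  adapted : StronglyAdapted 𝓕 Y
  initial : ∀ᵐ ω ∂Q, Y 0 ω = 0
  equation : ∀ᵐ ω ∂Q, ∀ t : ℝ≥0,
    IntervalIntegrable (fun s : ℝ ↦ Y s.toNNReal ω) volume 0 t ∧
    Y t ω = Y 0 ω + (∫ s in (0 : ℝ)..t, (-lam⁻¹ * Y s.toNNReal ω - φ)) + (Z t ω - Z 0 ω)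

/-- The price at time `t` of a futures contract with maturity `T` on the spot price `P`. -/
noncomputable def futuresPrice {Ω : Type*} {mΩ : MeasurableSpace Ω}
    (𝓕 : Filtration ℝ≥0 mΩ) (Q : Measure Ω) (P : ℝ≥0 → Ω → ℝ) (t T : ℝ≥0) : Ω → ℝ :=
  Q[P T | 𝓕 t]

end Futures

/-! The equation is linear with additive noise, so it can be solved path by path, without stochastic
calculus. With a = lam⁻¹, Y(T) is the decayed value of Y(t), a deterministic drift term and the
convolution of exp(-a (T - s)) with dZ(s). Integration by parts makes that convolution an ordinary
integral of the increments Z(s) - Z(t) (`eq_of_integrated_linear_equation`, `convolution`). Each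
increment is independent of 𝓕 t with mean m (s - t), so after Fubini the driver may be replaced by
the line m (s - t), and the convolution contributes (m / a) (1 - exp(-a (T - t))) to the conditional
mean (`IsDriver.setIntegral_convolution`).

The argument uses only the properties bundled in `IsDriver`, so the diffusive factor and the jump
factors are handled together by `IsOUSolution.condExp_ae_eq`: m = 0 for σ W, and m = θ / β for the
compound Poisson processes by Wald's identity. Fubini needs joint measurability, which comes from
right-continuity, and first moments bounded in time, which come from the L¹ contraction of
conditional expectation. Linearity then gives the price. -/

namespace Futures

/-! ### Pathwise solution of the linear equation -/

/-- Variation of constants: a path solving the integrated linear equation driven by a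
right-continuous path `z` is given by the explicit formula. -/
lemma eq_of_integrated_linear_equation {a φ t T : ℝ} (ha : a ≠ 0) (htT : t ≤ T) {y z : ℝ → ℝ}
    (hy : IntervalIntegrable y volume t T)
    (hz : ∀ s ∈ Icc t T, ContinuousWithinAt z (Ici s) s)
    (heq : ∀ s ∈ Icc t T, y s = y t + (∫ r in t..s, (-a * y r - φ)) + z s) :
    y T = y t * Real.exp (-a * (T - t)) - φ / a * (1 - Real.exp (-a * (T - t)))
      + (z T - a * ∫ s in t..T, Real.exp (-a * (T - s)) * z s) := by
  set h : ℝ → ℝ := fun r ↦ -a * y r - φ with hh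
  set H : ℝ → ℝ := fun s ↦ ∫ r in t..s, h r with hH
  set E : ℝ → ℝ := fun s ↦ Real.exp (-a * (T - s)) with hE
  have hEd : ∀ s, HasDerivAt E (a * E s) s := fun s ↦ by
    have h1 : HasDerivAt (fun s : ℝ ↦ -a * (T - s)) a s := by
      simpa using ((hasDerivAt_id s).const_sub T).const_mul (-a)
    simpa [hE, mul_comm] using h1.exp
  have hEc : Continuous E := by fun_prop
  have hh_int : IntervalIntegrable h volume t T :=
    (hy.const_mul (-a)).sub intervalIntegrable_const
  have hHc : ContinuousOn H (Icc t T) := by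
    have := intervalIntegral.continuousOn_primitive_interval'
      hh_int (left_mem_uIcc)
    rwa [uIcc_of_le htT] at this
  have hHi : IntervalIntegrable H volume t T := by
    apply ContinuousOn.intervalIntegrable
    rwa [uIcc_of_le htT]
  have hzi : IntervalIntegrable z volume t T := by
    have h1 : IntervalIntegrable (fun s ↦ y s - y t - H s) volume t T :=
      (hy.sub intervalIntegrable_const).sub hHi
    refine h1.congr fun s hs ↦ ?_
    have := heq s (uIcc_of_le htT ▸ uIoc_subset_uIcc hs)
    simp only [hH]
    linarith
  -- The path may jump, so `H` is only differentiated from the right; this suffices for the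
  -- fundamental theorem of calculus.
  have hyc : ∀ s ∈ Ico t T, ContinuousWithinAt h (Ioi s) s := by
    intro s hs
    have hsT : Icc t T ∈ nhdsWithin s (Ioi s) :=
      Filter.mem_of_superset (Ioc_mem_nhdsGT hs.2) fun r hr ↦ ⟨hs.1.trans hr.1.le, hr.2⟩
    have h1 : ContinuousWithinAt H (Ioi s) s :=
      (hHc s ⟨hs.1, hs.2.le⟩).mono_of_mem_nhdsWithin hsT
    have h2 : ContinuousWithinAt z (Ioi s) s := (hz s ⟨hs.1, hs.2.le⟩).mono Ioi_subset_Ici_self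
    have h3 : ContinuousWithinAt y (Ioi s) s := by
      refine ((continuousWithinAt_const (b := y t)).add h1 |>.add h2).congr_of_eventuallyEq ?_
        (heq s ⟨hs.1, hs.2.le⟩)
      filter_upwards [hsT] with r hr using heq r hr
    exact (h3.const_mul (-a)).sub continuousWithinAt_const
  have hHd : ∀ s ∈ Ioo t T, HasDerivWithinAt H (h s) (Ioi s) s := by
    intro s hs
    refine (intervalIntegral.integral_hasDerivWithinAt_right (s := Ici s) (t := Ioi s)
      (hh_int.mono_set (by
        rw [uIcc_of_le hs.1.le, uIcc_of_le htT]
        exact Icc_subset_Icc_right hs.2.le))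
      ⟨Ioc t T, Filter.mem_of_superset (Ioc_mem_nhdsGT hs.2) fun r hr ↦ ⟨hs.1.trans hr.1, hr.2⟩, ?_⟩
      (hyc s ⟨hs.1.le, hs.2⟩)).mono Ioi_subset_Ici_self
    exact ((intervalIntegrable_iff_integrableOn_Ioc_of_le htT).1 hh_int).aestronglyMeasurable
  have key : ∫ s in t..T, (a * E s * H s + E s * h s) = E T * H T - E t * H t := by
    refine intervalIntegral.integral_eq_sub_of_hasDeriv_right_of_le htT
      (hEc.continuousOn.mul hHc) (fun s hs ↦ (hEd s).hasDerivWithinAt.mul (hHd s hs)) ?_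
    exact (hHi.continuousOn_mul (by fun_prop)).add (hh_int.continuousOn_mul hEc.continuousOn)
  have hEz : IntervalIntegrable (fun s ↦ E s * z s) volume t T :=
    hzi.continuousOn_mul hEc.continuousOn
  have hEint : ∫ s in t..T, a * E s = E T - E t :=
    intervalIntegral.integral_eq_sub_of_hasDerivAt (fun s _ ↦ hEd s)
      (by apply Continuous.intervalIntegrable; fun_prop)
  -- Substituting `H s = y s - y t - z s` cancels `y s` in the integrand: only `y t`, `φ` and `z`
  -- remain.
  have key2 : ∫ s in t..T, (a * E s * H s + E s * h s)
      = -(y t + φ / a) * (E T - E t) - a * ∫ s in t..T, E s * z s := by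
    rw [← hEint, ← intervalIntegral.integral_const_mul, ← intervalIntegral.integral_const_mul,
      ← intervalIntegral.integral_sub (by apply Continuous.intervalIntegrable; fun_prop)
        (hEz.const_mul a)]
    refine intervalIntegral.integral_congr fun s hs ↦ ?_
    have := heq s (uIcc_of_le htT ▸ hs)
    simp only [hh, hH] at this ⊢
    rw [show (∫ r in t..s, (-a * y r - φ)) = y s - y t - z s by linarith]
    linear_combination E s * φ * mul_inv_cancel₀ ha
  have hHt : H t = 0 := by simp [hH]
  have hET : E T = 1 := by simp [hE]
  have hHT : H T = y T - y t - z T := by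
    have := heq T ⟨htT, le_rfl⟩
    simp only [hH]; linarith
  rw [key2, hHt, hET, hHT] at key
  change y T = y t * E t - φ / a * (1 - E t) + (z T - a * ∫ s in t..T, E s * z s)
  linarith

/-- The Ornstein-Uhlenbeck integral of a linear path. -/
lemma linear_sub_integral_exp_mul_linear {a : ℝ} (ha : a ≠ 0) (m t T : ℝ) :
    m * (T - t) - a * ∫ s in t..T, Real.exp (-a * (T - s)) * (m * (s - t))
      = m / a * (1 - Real.exp (-a * (T - t))) := by
  -- The antiderivative comes from one integration by parts.
  have hd : ∀ s, HasDerivAt (fun s ↦ Real.exp (-a * (T - s)) * (m / a * ((s - t) - 1 / a)))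
      (Real.exp (-a * (T - s)) * (m * (s - t))) s := fun s ↦ by
    have h1 : HasDerivAt (fun s : ℝ ↦ -a * (T - s)) a s := by
      simpa using ((hasDerivAt_id s).const_sub T).const_mul (-a)
    have h2 : HasDerivAt (fun s : ℝ ↦ m / a * ((s - t) - 1 / a)) (m / a) s := by
      simpa using (((hasDerivAt_id s).sub_const t).sub_const (1 / a)).const_mul (m / a)
    refine (h1.exp.mul h2).congr_deriv ?_
    field_simp
    ring
  rw [intervalIntegral.integral_eq_sub_of_hasDerivAt (fun s _ ↦ hd s)
      (by apply Continuous.intervalIntegrable; fun_prop)]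
  simp
  field_simp
  ring

/-! ### Joint measurability -/

/-- A measurable process with almost surely right-continuous paths is jointly a.e. measurable. -/
lemma aestronglyMeasurable_uncurry_of_rightContinuous {Ω : Type*} {mΩ : MeasurableSpace Ω}
    {Q : Measure Ω} [SFinite Q] (μ : Measure ℝ) [SFinite μ] {X : ℝ → Ω → ℝ}
    (hX : ∀ s, Measurable (X s))
    (hrc : ∀ᵐ ω ∂Q, ∀ s, ContinuousWithinAt (fun s ↦ X s ω) (Ici s) s) :
    AEStronglyMeasurable (Function.uncurry X) (μ.prod Q) := by
  -- Time is rounded up to the grid of mesh 1 / (n + 1): each approximation uses countably many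
  -- times and converges from the right.
  refine (aemeasurable_of_tendsto_metrizable_ae (u := Filter.atTop)
    (f := fun (n : ℕ) (p : ℝ × Ω) ↦ X (⌈((n : ℝ) + 1) * p.1⌉ / ((n : ℝ) + 1)) p.2)
    (fun n ↦ ?_) ?_).aestronglyMeasurable
  · have h1 : Measurable (fun q : ℤ × Ω ↦ X (q.1 / ((n : ℝ) + 1)) q.2) :=
      measurable_from_prod_countable_right fun k : ℤ ↦ hX (k / ((n : ℝ) + 1))
    have h2 : Measurable (fun p : ℝ × Ω ↦ (⌈((n : ℝ) + 1) * p.1⌉, p.2)) :=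
      (Int.measurable_ceil.comp (measurable_fst.const_mul _)).prodMk measurable_snd
    exact (h1.comp h2).aemeasurable
  · have h := Measure.quasiMeasurePreserving_snd (μ := μ) (ν := Q) |>.ae hrc
    filter_upwards [h] with p hp
    refine (hp p.1).tendsto.comp (tendsto_nhdsWithin_iff.2 ⟨?_, .of_forall fun n ↦ ?_⟩)
    · have h0 : Filter.Tendsto (fun n : ℕ ↦ p.1 + 1 / ((n : ℝ) + 1)) Filter.atTop (nhds p.1) := by
        simpa using tendsto_one_div_add_atTop_nhds_zero_nat.const_add p.1
      refine tendsto_of_tendsto_of_tendsto_of_le_of_le tendsto_const_nhds h0 (fun n ↦ ?_)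
        (fun n ↦ ?_)
      · have : (0 : ℝ) < (n : ℝ) + 1 := by positivity
        rw [le_div_iff₀ this, mul_comm]
        exact Int.le_ceil _
      · have : (0 : ℝ) < (n : ℝ) + 1 := by positivity
        change _ / _ ≤ p.1 + 1 / ((n : ℝ) + 1)
        rw [div_le_iff₀ this, add_mul p.1, one_div_mul_cancel this.ne', mul_comm p.1]
        exact (Int.ceil_lt_add_one _).le
    · have : (0 : ℝ) < (n : ℝ) + 1 := by positivity
      rw [mem_Ici, le_div_iff₀ this, mul_comm]
      exact Int.le_ceil _

/-! ### Means of the exponential, Poisson and compound Poisson laws -/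

/-- The mean of the exponential distribution, as a Lebesgue integral. -/
lemma lintegral_ofReal_expMeasure {β : ℝ} (hβ : 0 < β) :
    ∫⁻ x, ENNReal.ofReal x ∂(expMeasure β) = ENNReal.ofReal (1 / β) := by
  have hm : ∀ a, Measurable (gammaPDF a β) := fun a ↦
    (measurable_gammaPDFReal a β).ennreal_ofReal
  rw [expMeasure, gammaMeasure, lintegral_withDensity_eq_lintegral_mul _ (hm 1) (by fun_prop)]
  -- Size-biasing the Gamma(1, β) density gives 1 / β times the Gamma(2, β) density, whose total
  -- mass is known.
  have h : ∀ x, (gammaPDF 1 β * fun x ↦ ENNReal.ofReal x) x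
      = ENNReal.ofReal (1 / β) * gammaPDF 2 β x := fun x ↦ by
    rcases lt_or_ge x 0 with hx | hx
    · simp [gammaPDF_of_neg hx]
    · rw [Pi.mul_apply, gammaPDF_of_nonneg hx, gammaPDF_of_nonneg hx,
        ← ENNReal.ofReal_mul' hx, ← ENNReal.ofReal_mul (by positivity)]
      congr 1
      have h1 : (2 : ℝ) - 1 = 1 := by norm_num
      rw [sub_self, h1, Real.rpow_zero, Real.rpow_one, Real.rpow_one, Real.Gamma_one,
        Real.Gamma_two, Real.rpow_two]
      field_simp
  simp_rw [h]
  rw [lintegral_const_mul _ (hm 2), lintegral_gammaPDF_eq_one two_pos hβ, mul_one]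

/-- The exponential distribution is carried by the nonnegative reals. -/
lemma ae_nonneg_expMeasure (β : ℝ) : ∀ᵐ x ∂(expMeasure β), 0 ≤ x := by
  have hm : Measurable (gammaPDF 1 β) := (measurable_gammaPDFReal 1 β).ennreal_ofReal
  rw [expMeasure, gammaMeasure, ae_withDensity_iff hm]
  filter_upwards with x hx
  by_contra! h
  exact hx (gammaPDF_of_neg h)

/-- The mean of the Poisson distribution, as a Lebesgue integral. -/
lemma lintegral_natCast_poissonMeasure (r : ℝ≥0) :
    ∫⁻ n, (n : ENNReal) ∂(poissonMeasure r) = r := by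
  have h1 : ∑' n : ℕ, ENNReal.ofReal (Real.exp (-r) * r ^ n / n.factorial) = 1 := by
    rw [← ENNReal.ofReal_tsum_of_nonneg (fun n ↦ by positivity)
      (hasSum_one_poissonMeasure r).summable, (hasSum_one_poissonMeasure r).tsum_eq,
      ENNReal.ofReal_one]
  rw [lintegral_countable']
  simp_rw [poissonMeasure_singleton]
  rw [tsum_eq_zero_add' ENNReal.summable, Nat.cast_zero, zero_mul, zero_add]
  -- Size-biasing shifts the Poisson weights: (n + 1) p(n + 1) = r p(n).
  have h2 : ∀ n : ℕ, ((n + 1 : ℕ) : ENNReal)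
      * ENNReal.ofReal (Real.exp (-r) * r ^ (n + 1) / (n + 1).factorial)
      = r * ENNReal.ofReal (Real.exp (-r) * r ^ n / n.factorial) := fun n ↦ by
    rw [← ENNReal.ofReal_natCast, ← ENNReal.ofReal_coe_nnreal,
      ← ENNReal.ofReal_mul (by positivity), ← ENNReal.ofReal_mul (by positivity),
      Nat.factorial_succ]
    congr 1
    push_cast
    field_simp
    ring
  simp_rw [h2]
  rw [ENNReal.tsum_mul_left, h1, mul_one]

variable {Ω : Type*} {mΩ : MeasurableSpace Ω} {Q : Measure Ω}

lemma IsPoissonProcess.lintegral_natCast {θ : ℝ≥0} {N : ℝ≥0 → Ω → ℕ}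
    (hN : IsPoissonProcess Q θ N) (t : ℝ≥0) :
    ∫⁻ ω, (N t ω : ENNReal) ∂Q = θ * t := by
  have hlaw := hN.law 0 t (zero_le)
  have h1 : ∫⁻ ω, (N t ω : ENNReal) ∂Q
      = ∫⁻ ω, ENNReal.ofReal ((N t ω : ℝ) - (N 0 ω : ℝ)) ∂Q := by
    refine lintegral_congr_ae ?_
    filter_upwards [hN.zero] with ω hω
    simp [hω]
  rw [h1, hlaw.lintegral_comp (f := ENNReal.ofReal) (by fun_prop),
    lintegral_map (by fun_prop) (by fun_prop)]
  simp only [ENNReal.ofReal_natCast]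
  rw [lintegral_natCast_poissonMeasure]
  simp

/-- Wald's identity for sums of nonnegative variables that are independent of the number of
terms. -/
lemma lintegral_sum_range_of_indepFun {ξ : ℕ → Ω → ℝ} {M : Ω → ℕ} {c : ENNReal}
    (hξ : ∀ j, Measurable (ξ j)) (hM : Measurable M)
    (hind : ∀ j, IndepFun (ξ j) M Q) (hc : ∀ j, ∫⁻ ω, ENNReal.ofReal (ξ j ω) ∂Q = c) :
    ∫⁻ ω, ∑ j ∈ Finset.range (M ω), ENNReal.ofReal (ξ j ω) ∂Q
      = (∫⁻ ω, (M ω : ENNReal) ∂Q) * c := by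
  have hφ : ∀ j : ℕ, Measurable fun n : ℕ ↦ if j < n then (1 : ENNReal) else 0 :=
    fun j ↦ measurable_of_countable _
  -- Indicators of j < M turn the random range into a fixed series, so Tonelli and independence
  -- apply term by term.
  have h1 : ∀ ω, ∑ j ∈ Finset.range (M ω), ENNReal.ofReal (ξ j ω)
      = ∑' j, ENNReal.ofReal (ξ j ω) * (if j < M ω then 1 else 0) := fun ω ↦ by
    rw [tsum_eq_sum (s := Finset.range (M ω)) (fun j hj ↦ by simp_all)]
    exact Finset.sum_congr rfl fun j hj ↦ by simp_all
  have h2 : ∀ ω, (M ω : ENNReal) = ∑' j, (if j < M ω then (1 : ENNReal) else 0) := fun ω ↦ by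
    rw [tsum_eq_sum (s := Finset.range (M ω)) (fun j hj ↦ by simp_all)]
    rw [Finset.sum_congr rfl (g := fun _ ↦ (1 : ENNReal)) fun j hj ↦ by simp_all]
    simp
  simp_rw [h1, h2]
  have h3 : ∀ j, Measurable fun ω ↦ if j < M ω then (1 : ENNReal) else 0 :=
    fun j ↦ (hφ j).comp hM
  have h4 : ∀ j, Measurable fun ω ↦ ENNReal.ofReal (ξ j ω) * (if j < M ω then 1 else 0) :=
    fun j ↦ (hξ j).ennreal_ofReal.mul (h3 j)
  rw [lintegral_tsum fun j ↦ (h4 j).aemeasurable,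
    lintegral_tsum fun j ↦ (h3 j).aemeasurable, ← ENNReal.tsum_mul_right]
  refine tsum_congr fun j ↦ ?_
  have := lintegral_mul_eq_lintegral_mul_lintegral_of_indepFun (μ := Q)
    (hξ j).ennreal_ofReal (h3 j)
    ((hind j).comp ENNReal.measurable_ofReal (hφ j))
  simp only [Pi.mul_apply] at this
  rw [this, hc, mul_comm]

/-- A compound Poisson process with nonnegative jumps of mean `c` is integrable, with mean
`θ c t`. -/
lemma IsCompoundPoisson.integrable_and_integral {θ : ℝ≥0} {ν : Measure ℝ} {X : ℝ≥0 → Ω → ℝ}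
    (hX : IsCompoundPoisson Q θ ν X) (hν : ∀ᵐ x ∂ν, 0 ≤ x) {c : ℝ} (hc : 0 ≤ c)
    (hmean : ∫⁻ x, ENNReal.ofReal x ∂ν = ENNReal.ofReal c) {t : ℝ≥0}
    (hXm : AEStronglyMeasurable (X t) Q) :
    Integrable (X t) Q ∧ ∫ ω, X t ω ∂Q = θ * c * t := by
  obtain ⟨N, ξ, hN, hξm, hξlaw, -, hind, hsum⟩ := hX
  have hξ0 : ∀ᵐ ω ∂Q, ∀ j, 0 ≤ ξ j ω := by
    rw [ae_all_iff]
    intro j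
    have : ∀ᵐ x ∂(Q.map (ξ j)), 0 ≤ x := by rwa [(hξlaw j).map_eq]
    exact ae_of_ae_map (hξm j).aemeasurable this
  have hX0 : 0 ≤ᵐ[Q] X t := by
    filter_upwards [hξ0, hsum] with ω h1 h2
    rw [h2 t]
    exact Finset.sum_nonneg fun j _ ↦ h1 j
  have hl : ∫⁻ ω, ENNReal.ofReal (X t ω) ∂Q = ENNReal.ofReal (θ * c * t) := by
    have h1 : ∫⁻ ω, ENNReal.ofReal (X t ω) ∂Q
        = ∫⁻ ω, ∑ j ∈ Finset.range (N t ω), ENNReal.ofReal (ξ j ω) ∂Q := by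
      refine lintegral_congr_ae ?_
      filter_upwards [hξ0, hsum] with ω h1 h2
      rw [h2 t, ENNReal.ofReal_sum_of_nonneg fun j _ ↦ h1 j]
    rw [h1, lintegral_sum_range_of_indepFun hξm (hN.measurable t) (c := ENNReal.ofReal c)
      (fun j ↦ hind.comp (measurable_pi_apply j) (measurable_pi_apply t))
      (fun j ↦ by rw [(hξlaw j).lintegral_comp (by fun_prop), hmean]), hN.lintegral_natCast,
      ← ENNReal.ofReal_coe_nnreal, ← ENNReal.ofReal_coe_nnreal,
      ← ENNReal.ofReal_mul (by positivity), ← ENNReal.ofReal_mul (by positivity)]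
    congr 1
    ring
  refine ⟨⟨hXm, ?_⟩, ?_⟩
  · rw [hasFiniteIntegral_iff_ofReal hX0, hl]
    exact ENNReal.ofReal_lt_top
  · rw [integral_eq_lintegral_of_nonneg_ae hX0 hXm, hl, ENNReal.toReal_ofReal (by positivity)]

/-- The paths of a compound Poisson process are almost surely right-continuous. -/
lemma IsCompoundPoisson.rightContinuous {θ : ℝ≥0} {ν : Measure ℝ} {X : ℝ≥0 → Ω → ℝ}
    (hX : IsCompoundPoisson Q θ ν X) :
    ∀ᵐ ω ∂Q, ∀ t : ℝ≥0, ContinuousWithinAt (fun s ↦ X s ω) (Ici t) t := by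
  obtain ⟨N, ξ, hN, -, -, -, -, hsum⟩ := hX
  filter_upwards [hN.rightContinuous, hsum] with ω h1 h2 t
  have h3 : (fun s ↦ X s ω) = (fun n : ℕ ↦ ∑ j ∈ Finset.range n, ξ j ω) ∘ fun s ↦ N s ω :=
    funext h2
  rw [h3]
  exact continuous_of_discreteTopology.continuousAt.comp_continuousWithinAt (h1 t)

/-! ### Drivers and their stochastic convolutions -/

/-- An adapted integrable process with almost surely right-continuous paths, whose increments are
independent of the past and which has mean `m * t`. -/
structure IsDriver (𝓕 : Filtration ℝ≥0 mΩ) (Q : Measure Ω) (m : ℝ) (Z : ℝ≥0 → Ω → ℝ) : Prop where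
  adapted : StronglyAdapted 𝓕 Z
  indep : IncrementsIndepOfPast 𝓕 Q Z
  rightContinuous : ∀ᵐ ω ∂Q, ∀ t : ℝ≥0, ContinuousWithinAt (fun s ↦ Z s ω) (Ici t) t
  integrable : ∀ t, Integrable (Z t) Q
  mean : ∀ t, ∫ ω, Z t ω ∂Q = m * t

lemma IsFiltrationBrownian.isDriver {𝓕 : Filtration ℝ≥0 mΩ} {W : ℝ≥0 → Ω → ℝ}
    (hW : IsFiltrationBrownian 𝓕 Q W) : IsDriver 𝓕 Q 0 W where
  adapted := hW.adapted
  indep := hW.indep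
  rightContinuous := by
    filter_upwards [hW.brownian.cont] with ω hω t using hω.continuousWithinAt
  integrable := hW.brownian.integrable_eval
  mean t := by rw [hW.brownian.integral_eval, zero_mul]

lemma IsFiltrationCompoundPoisson.isDriver {𝓕 : Filtration ℝ≥0 mΩ} {θ : ℝ≥0} {β : ℝ} (hβ : 0 < β)
    {X : ℝ≥0 → Ω → ℝ} (hX : IsFiltrationCompoundPoisson 𝓕 Q θ (expMeasure β) X) :
    IsDriver 𝓕 Q (θ / β) X where
  adapted := hX.adapted
  indep := hX.indep
  rightContinuous := hX.compoundPoisson.rightContinuous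
  integrable t := (hX.compoundPoisson.integrable_and_integral (ae_nonneg_expMeasure β)
    (by positivity) (lintegral_ofReal_expMeasure hβ)
    ((hX.adapted t).mono (𝓕.le t)).aestronglyMeasurable).1
  mean t := by
    rw [(hX.compoundPoisson.integrable_and_integral (ae_nonneg_expMeasure β)
      (by positivity) (lintegral_ofReal_expMeasure hβ)
      ((hX.adapted t).mono (𝓕.le t)).aestronglyMeasurable).2]
    ring

/-- The stochastic convolution `∫_t^T exp(-a (T - s)) dZ(s)`, integrated by parts. -/
noncomputable def convolution (a : ℝ) (Z : ℝ≥0 → Ω → ℝ) (t T : ℝ≥0) (ω : Ω) : ℝ :=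
  (Z T ω - Z t ω)
    - a * ∫ s in (t : ℝ)..T, Real.exp (-a * (T - s)) * (Z s.toNNReal ω - Z t ω)

namespace IsDriver

variable {𝓕 : Filtration ℝ≥0 mΩ} {m : ℝ} {Z : ℝ≥0 → Ω → ℝ}

lemma const_mul (hZ : IsDriver 𝓕 Q m Z) (c : ℝ) : IsDriver 𝓕 Q (c * m) (fun t ω ↦ c * Z t ω) where
  adapted t := (hZ.adapted t).const_mul c
  indep s t hst := by
    refine indep_of_indep_of_le_left (hZ.indep s t hst) ?_
    have : (fun ω ↦ c * Z t ω - c * Z s ω) = (fun x ↦ c * x) ∘ fun ω ↦ Z t ω - Z s ω := by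
      ext ω; simp [mul_sub]
    rw [this, ← MeasurableSpace.comap_comp]
    exact MeasurableSpace.comap_mono (measurable_const_mul c).comap_le
  rightContinuous := by
    filter_upwards [hZ.rightContinuous] with ω hω t using (hω t).const_mul c
  integrable t := (hZ.integrable t).const_mul c
  mean t := by rw [integral_const_mul, hZ.mean, mul_assoc]

lemma measurable (hZ : IsDriver 𝓕 Q m Z) (t : ℝ≥0) : Measurable (Z t) :=
  ((hZ.adapted t).mono (𝓕.le t)).measurable

lemma integral_sub (hZ : IsDriver 𝓕 Q m Z) (s t : ℝ≥0) :
    ∫ ω, (Z t ω - Z s ω) ∂Q = m * (t - s) := by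
  rw [MeasureTheory.integral_sub (hZ.integrable t) (hZ.integrable s), hZ.mean, hZ.mean, mul_sub]

lemma setIntegral_sub (hZ : IsDriver 𝓕 Q m Z) {s t : ℝ≥0} (hst : s ≤ t) {A : Set Ω}
    (hA : MeasurableSet[𝓕 s] A) :
    ∫ ω in A, (Z t ω - Z s ω) ∂Q = Q.real A * (m * (t - s)) := by
  rw [← hZ.integral_sub]
  exact Indep.setIntegral_eq_mul (𝓕.le s) (f := id) (hZ.indep s t hst).symm
    ((hZ.measurable t).sub (hZ.measurable s)).aemeasurable hA (by fun_prop)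

lemma condExp_sub [IsProbabilityMeasure Q] (hZ : IsDriver 𝓕 Q m Z) {s t : ℝ≥0} (hst : s ≤ t) :
    Q[fun ω ↦ Z t ω - Z s ω | 𝓕 s] =ᵐ[Q] fun _ ↦ m * (t - s) := by
  rw [← hZ.integral_sub]
  exact condExp_indep_eq ((hZ.measurable t).sub (hZ.measurable s)).comap_le (𝓕.le s)
    (comap_measurable _).stronglyMeasurable (hZ.indep s t hst)

/-- The first absolute moments of a driver are bounded on compact intervals. -/
lemma integral_abs_le [IsProbabilityMeasure Q] (hZ : IsDriver 𝓕 Q m Z) {s t : ℝ≥0} (hst : s ≤ t) :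
    ∫ ω, |Z s ω| ∂Q ≤ ∫ ω, |Z t ω| ∂Q + |m| * t := by
  -- A driver is a martingale up to the drift m (t - s), so the L¹ contraction bounds earlier
  -- moments by later ones.
  have h1 : Q[Z t | 𝓕 s] =ᵐ[Q] fun ω ↦ Z s ω + m * (t - s) := by
    have h2 := condExp_add (hZ.integrable s) ((hZ.integrable t).sub (hZ.integrable s)) (𝓕 s)
    rw [add_sub_cancel, condExp_of_stronglyMeasurable (𝓕.le s) (hZ.adapted s) (hZ.integrable s)]
      at h2
    filter_upwards [h2, hZ.condExp_sub hst] with ω h3 h4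
    rw [h3, Pi.add_apply]
    congr 1
  have h5 : ∫ ω, |Z s ω + m * (t - s)| ∂Q ≤ ∫ ω, |Z t ω| ∂Q := by
    refine (integral_congr_ae ?_).trans_le (integral_abs_condExp_le (m := 𝓕 s) (Z t))
    filter_upwards [h1] with ω h2
    rw [h2]
  have hi : Integrable (fun ω ↦ |Z s ω + m * (t - s)|) Q :=
    ((hZ.integrable s).add (integrable_const _)).abs
  have h6 : ∫ ω, |Z s ω| ∂Q ≤ ∫ ω, (|Z s ω + m * (t - s)| + |m| * t) ∂Q := by
    refine integral_mono (hZ.integrable s).abs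
      (hi.add (integrable_const _)) fun ω ↦ ?_
    have hst' : (s : ℝ) ≤ t := hst
    have : |m * (t - s)| ≤ |m| * t := by
      rw [abs_mul, abs_of_nonneg (sub_nonneg.2 hst')]
      gcongr
      linarith [s.2]
    calc |Z s ω| = |(Z s ω + m * (t - s)) - m * (t - s)| := by ring_nf
      _ ≤ |Z s ω + m * (t - s)| + |m * (t - s)| := abs_sub _ _
      _ ≤ _ := by gcongr
  rw [integral_add hi (integrable_const _)] at h6
  simp only [integral_const, probReal_univ, one_smul] at h6
  linarith

/-- The weighted increments of a driver are jointly integrable in time and chance. -/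
lemma integrable_exp_mul_sub [IsProbabilityMeasure Q] (hZ : IsDriver 𝓕 Q m Z) (a : ℝ)
    {t T : ℝ≥0} (htT : t ≤ T) :
    Integrable (Function.uncurry fun (s : ℝ) ω ↦
      Real.exp (-a * (T - s)) * (Z s.toNNReal ω - Z t ω))
      ((volume.restrict (Ioc (t : ℝ) T)).prod Q) := by
  have hmeas : AEStronglyMeasurable (Function.uncurry fun (s : ℝ) ω ↦
      Real.exp (-a * (T - s)) * (Z s.toNNReal ω - Z t ω))
      ((volume.restrict (Ioc (t : ℝ) T)).prod Q) := by
    refine aestronglyMeasurable_uncurry_of_rightContinuous _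
      (fun s ↦ ((hZ.measurable _).sub (hZ.measurable _)).const_mul _) ?_
    filter_upwards [hZ.rightContinuous] with ω hω s
    refine ContinuousWithinAt.mul (by fun_prop) (ContinuousWithinAt.sub ?_ (by fun_prop))
    exact (hω s.toNNReal).comp continuous_real_toNNReal.continuousWithinAt
      fun r hr ↦ Real.toNNReal_le_toNNReal hr
  have hint : ∀ s : ℝ, Integrable (fun ω ↦ Z s.toNNReal ω - Z t ω) Q :=
    fun s ↦ (hZ.integrable _).sub (hZ.integrable _)
  rw [integrable_prod_iff hmeas]
  refine ⟨.of_forall fun s ↦ (hint s).const_mul (Real.exp (-a * (T - s))), ?_⟩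
  -- The factor 2 covers `Z s` and `Z t`, each bounded through the moment at `T`.
  refine Integrable.mono' (g := fun s ↦ Real.exp (-a * (T - s)) *
    (2 * (∫ ω, |Z T ω| ∂Q + |m| * T))) ?_ hmeas.norm.integral_prod_right' ?_
  · exact (Continuous.integrableOn_Icc (by fun_prop)).mono_set Ioc_subset_Icc_self
  · refine ae_restrict_of_forall_mem measurableSet_Ioc fun s hs ↦ ?_
    rw [Real.norm_of_nonneg (integral_nonneg fun _ ↦ norm_nonneg _)]
    simp only [Function.uncurry, norm_mul, Real.norm_eq_abs, Real.abs_exp]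
    rw [integral_const_mul]
    gcongr
    have hsT : s.toNNReal ≤ T := Real.toNNReal_le_iff_le_coe.2 hs.2
    calc ∫ ω, |Z s.toNNReal ω - Z t ω| ∂Q ≤ ∫ ω, (|Z s.toNNReal ω| + |Z t ω|) ∂Q :=
          integral_mono (hint s).abs ((hZ.integrable _).abs.add (hZ.integrable _).abs)
            fun ω ↦ abs_sub _ _
      _ = ∫ ω, |Z s.toNNReal ω| ∂Q + ∫ ω, |Z t ω| ∂Q :=
          integral_add (hZ.integrable _).abs (hZ.integrable _).abs
      _ ≤ _ := by linarith [hZ.integral_abs_le hsT, hZ.integral_abs_le htT]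

lemma integrable_convolution [IsProbabilityMeasure Q] (hZ : IsDriver 𝓕 Q m Z) (a : ℝ)
    {t T : ℝ≥0} (htT : t ≤ T) : Integrable (convolution a Z t T) Q := by
  refine ((hZ.integrable T).sub (hZ.integrable t)).sub (Integrable.const_mul ?_ a)
  simp_rw [intervalIntegral.integral_of_le (NNReal.coe_le_coe.2 htT)]
  exact (hZ.integrable_exp_mul_sub a htT).integral_prod_right

/-- Fubini reduces the claim to single increments, so independence of the whole future path from 𝓕 t
is never needed. Letting `A` vary identifies the conditional mean. -/
lemma setIntegral_convolution [IsProbabilityMeasure Q] (hZ : IsDriver 𝓕 Q m Z) {a : ℝ}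
    (ha : a ≠ 0) {t T : ℝ≥0} (htT : t ≤ T) {A : Set Ω} (hA : MeasurableSet[𝓕 t] A) :
    ∫ ω in A, convolution a Z t T ω ∂Q
      = Q.real A * (m / a * (1 - Real.exp (-a * (T - t)))) := by
  have htT' : (t : ℝ) ≤ T := htT
  have hprod := hZ.integrable_exp_mul_sub a htT
  have hprodA : Integrable (Function.uncurry fun (s : ℝ) ω ↦
      Real.exp (-a * (T - s)) * (Z s.toNNReal ω - Z t ω))
      ((volume.restrict (Ioc (t : ℝ) T)).prod (Q.restrict A)) :=
    hprod.mono_measure (Measure.prod_mono le_rfl Measure.restrict_le_self)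
  have hsub : Integrable (fun ω ↦ Z T ω - Z t ω) Q := (hZ.integrable T).sub (hZ.integrable t)
  simp only [convolution]
  rw [MeasureTheory.integral_sub hsub.integrableOn,
    hZ.setIntegral_sub htT hA, integral_const_mul, ← linear_sub_integral_exp_mul_linear ha]
  · simp_rw [intervalIntegral.integral_of_le htT']
    rw [← integral_integral_swap hprodA, mul_sub (Q.real A), mul_left_comm _ a,
      ← integral_const_mul (Q.real A)]
    congr 2
    refine setIntegral_congr_fun measurableSet_Ioc fun (s : ℝ) hs ↦ ?_
    have hs0 : 0 ≤ s := t.2.trans hs.1.le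
    have hts : t ≤ s.toNNReal := NNReal.le_toNNReal_of_coe_le hs.1.le
    rw [integral_const_mul, hZ.setIntegral_sub hts hA, Real.coe_toNNReal s hs0]
    ring
  · simp_rw [intervalIntegral.integral_of_le htT']
    exact (hprodA.integral_prod_right).const_mul a

end IsDriver

/-! ### Ornstein-Uhlenbeck factors and the futures price -/

variable {𝓕 : Filtration ℝ≥0 mΩ} {m lam φ : ℝ} {Z Y : ℝ≥0 → Ω → ℝ}

/-- The explicit solution of the generalized Ornstein-Uhlenbeck equation. -/
lemma IsOUSolution.ae_eq_convolution (hY : IsOUSolution 𝓕 Q lam φ Z Y) (hlam : 0 < lam)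
    (hZ : ∀ᵐ ω ∂Q, ∀ t : ℝ≥0, ContinuousWithinAt (fun s ↦ Z s ω) (Ici t) t)
    {t T : ℝ≥0} (htT : t ≤ T) :
    ∀ᵐ ω ∂Q, Y T ω = Y t ω * Real.exp (-lam⁻¹ * (T - t))
      - φ / lam⁻¹ * (1 - Real.exp (-lam⁻¹ * (T - t))) + convolution lam⁻¹ Z t T ω := by
  filter_upwards [hY.equation, hZ] with ω hω hrc
  have hint : ∀ s : ℝ≥0, IntervalIntegrable (fun s : ℝ ↦ Y s.toNNReal ω) volume t s :=
    fun s ↦ (hω t).1.symm.trans (hω s).1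
  have hint' : ∀ s : ℝ≥0,
      IntervalIntegrable (fun s : ℝ ↦ -lam⁻¹ * Y s.toNNReal ω - φ) volume 0 s :=
    fun s ↦ ((hω s).1.const_mul _).sub intervalIntegrable_const
  -- The equation is restarted at `t` by subtracting its instance at `t` from that at `s`; hence the
  -- recentred driver.
  have := eq_of_integrated_linear_equation (a := lam⁻¹) (φ := φ) (inv_pos.2 hlam).ne'
    (NNReal.coe_le_coe.2 htT) (y := fun s ↦ Y s.toNNReal ω)
    (z := fun s ↦ Z s.toNNReal ω - Z t ω) (hint T) (fun s _ ↦ ?_) (fun s hs ↦ ?_)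
  · simpa [convolution] using this
  · refine ContinuousWithinAt.sub ?_ (by fun_prop)
    exact (hrc s.toNNReal).comp continuous_real_toNNReal.continuousWithinAt
      fun r hr ↦ Real.toNNReal_le_toNNReal hr
  · have hs0 : 0 ≤ s := t.2.trans hs.1
    lift s to ℝ≥0 using hs0
    have h1 := (hω s).2
    have h2 := (hω t).2
    have h3 := intervalIntegral.integral_interval_sub_left (hint' s) (hint' t)
    simp only [Real.toNNReal_coe]
    linarith

/-- Solutions of the generalized Ornstein-Uhlenbeck equation are integrable. -/
lemma IsOUSolution.integrable [IsProbabilityMeasure Q] (hY : IsOUSolution 𝓕 Q lam φ Z Y)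
    (hlam : 0 < lam) (hZ : IsDriver 𝓕 Q m Z) (T : ℝ≥0) : Integrable (Y T) Q := by
  have h : Integrable (fun ω ↦ 0 * Real.exp (-lam⁻¹ * (T - (0 : ℝ≥0)))
      - φ / lam⁻¹ * (1 - Real.exp (-lam⁻¹ * (T - (0 : ℝ≥0))))
      + convolution lam⁻¹ Z 0 T ω) Q :=
    (integrable_const _).add (hZ.integrable_convolution _ zero_le)
  refine h.congr ?_
  filter_upwards [hY.ae_eq_convolution hlam hZ.rightContinuous (zero_le (a := T)), hY.initial]
    with ω h1 h2
  rw [h1, h2]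

/-- The conditional mean of a solution of the generalized Ornstein-Uhlenbeck equation. -/
theorem IsOUSolution.condExp_ae_eq [IsProbabilityMeasure Q] (hY : IsOUSolution 𝓕 Q lam φ Z Y)
    (hlam : 0 < lam) (hZ : IsDriver 𝓕 Q m Z) {t T : ℝ≥0} (htT : t ≤ T) :
    Q[Y T | 𝓕 t] =ᵐ[Q] fun ω ↦ Y t ω * Real.exp (-lam⁻¹ * (T - t))
      + (m - φ) * lam * (1 - Real.exp (-lam⁻¹ * (T - t))) := by
  have hYt : Integrable (fun ω ↦ Y t ω * Real.exp (-lam⁻¹ * (T - t))) Q :=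
    (hY.integrable hlam hZ t).mul_const _
  have hYt' : Integrable (fun ω ↦ Y t ω * Real.exp (-lam⁻¹ * (T - t))
      - φ / lam⁻¹ * (1 - Real.exp (-lam⁻¹ * (T - t)))) Q := hYt.sub (integrable_const _)
  refine (ae_eq_condExp_of_forall_setIntegral_eq (𝓕.le t) (hY.integrable hlam hZ T)
    (fun A _ _ ↦ (hYt.add (integrable_const _)).integrableOn) (fun A hA _ ↦ ?_)
    (((hY.adapted t).mul_const _).add stronglyMeasurable_const).aestronglyMeasurable).symm
  rw [setIntegral_congr_ae (𝓕.le t A hA) ((hY.ae_eq_convolution hlam hZ.rightContinuous htT).mono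
      fun ω h _ ↦ h)]
  simp only [Pi.add_apply]
  rw [integral_add hYt.integrableOn (integrable_const _),
    integral_add hYt'.integrableOn
      (hZ.integrable_convolution _ htT).integrableOn,
    integral_sub hYt.integrableOn (integrable_const _),
    hZ.setIntegral_convolution (inv_pos.2 hlam).ne' htT hA]
  simp only [integral_const, measureReal_restrict_apply_univ, smul_eq_mul, div_inv_eq_mul]
  ring

end Futures

theorem corollary1 {Ω : Type*} {mΩ : MeasurableSpace Ω}
    (Q : Measure Ω) [IsProbabilityMeasure Q]
    (𝓕 : Filtration ℝ≥0 mΩ) (h𝓕 : Futures.UsualConditions 𝓕 Q)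
    -- model parameters under the risk neutral measure
    (lamY lamJ₁ lamJ₂ σY φY β₁ β₂ : ℝ) (θ₁ θ₂ : ℝ≥0)
    (hlamY : 0 < lamY) (hlamJ₁ : 0 < lamJ₁) (hlamJ₂ : 0 < lamJ₂)
    (hβ₁ : 0 < β₁) (hβ₂ : 0 < β₂)
    -- driving processes
    (W CP₁ CP₂ : ℝ≥0 → Ω → ℝ)
    (hW : Futures.IsFiltrationBrownian 𝓕 Q W)
    (hCP₁ : Futures.IsFiltrationCompoundPoisson 𝓕 Q θ₁ (expMeasure β₁) CP₁)
    (hCP₂ : Futures.IsFiltrationCompoundPoisson 𝓕 Q θ₂ (expMeasure β₂) CP₂)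
    -- the three factors and the spot price
    (Y J₁ J₂ P : ℝ≥0 → Ω → ℝ) (f : ℝ≥0 → ℝ)
    (hY : Futures.IsOUSolution 𝓕 Q lamY φY (fun t ω ↦ σY * W t ω) Y)
    (hJ₁ : Futures.IsOUSolution 𝓕 Q lamJ₁ 0 CP₁ J₁)
    (hJ₂ : Futures.IsOUSolution 𝓕 Q lamJ₂ 0 CP₂ J₂)
    (hP : ∀ t ω, P t ω = f t + (Y t ω + J₁ t ω - J₂ t ω))
    -- current time and maturity
    (t T : ℝ≥0) (htT : t ≤ T) :
    Integrable (P T) Q ∧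
    Futures.futuresPrice 𝓕 Q P t T =ᵐ[Q] fun ω ↦
      f T
        + Y t ω * Real.exp (-lamY⁻¹ * ((T : ℝ) - t))
        - φY / lamY⁻¹ * (1 - Real.exp (-lamY⁻¹ * ((T : ℝ) - t)))
        + J₁ t ω * Real.exp (-lamJ₁⁻¹ * ((T : ℝ) - t))
        + θ₁ / β₁ * lamJ₁ * (1 - Real.exp (-lamJ₁⁻¹ * ((T : ℝ) - t)))
        - J₂ t ω * Real.exp (-lamJ₂⁻¹ * ((T : ℝ) - t))
        - θ₂ / β₂ * lamJ₂ * (1 - Real.exp (-lamJ₂⁻¹ * ((T : ℝ) - t))) := by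
  -- The mean rate here is `σY * 0`, so the volatility drops out of the price.
  have hdW := hW.isDriver.const_mul σY
  have hd₁ := hCP₁.isDriver hβ₁
  have hd₂ := hCP₂.isDriver hβ₂
  have hiY := hY.integrable hlamY hdW T
  have hi₁ := hJ₁.integrable hlamJ₁ hd₁ T
  have hi₂ := hJ₂.integrable hlamJ₂ hd₂ T
  have hPT : P T = (fun _ ↦ f T) + (Y T + J₁ T - J₂ T) := funext fun ω ↦ hP T ω
  have hi := (hiY.add hi₁).sub hi₂
  refine ⟨hPT ▸ (integrable_const _).add hi, ?_⟩
  rw [Futures.futuresPrice, hPT]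
  filter_upwards [condExp_add (integrable_const (f T)) hi (𝓕 t),
    condExp_sub (hiY.add hi₁) hi₂ (𝓕 t), condExp_add hiY hi₁ (𝓕 t),
    hY.condExp_ae_eq hlamY hdW htT, hJ₁.condExp_ae_eq hlamJ₁ hd₁ htT,
    hJ₂.condExp_ae_eq hlamJ₂ hd₂ htT] with ω h1 h2 h3 h4 h5 h6
  rw [h1, Pi.add_apply, h2, Pi.sub_apply, h3, Pi.add_apply, h4, h5, h6,
    condExp_const (𝓕.le t), div_inv_eq_mul]
  ring
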